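/- Let $\Sigma$ be a finite alphabet containing two distinct letters $a \neq b$. For $w \in \Sigma^*$ let $\mathsf{Facs}(w)$ be the set of factors (contiguous subwords, including the empty word $\varepsilon$ and $w$ itself) of $w$. The formulas of the logic $\mathsf{FC}$ are built from atoms $(x \doteq y \cdot z)$, where each of $x,y,z$ is a variable (from a countably infinite set), a letter of $\Sigma$, or $\varepsilon$, by means of $\land$, $\lor$, $\neg$, $\forall x$ and $\exists x$. A formula is interpreted over a word $w \in \Sigma^*$ as follows: variables are assigned elements of $\mathsf{Facs}(w)$ and quantifiers range over $\mathsf{Facs}(w)$; the constant $\varepsilon$ denotes the empty word; the constant for a letter $c$ denotes the word $c$ if $c$ occurs in $w$, and a null value $\perp \notin \mathsf{Facs}(w)$ otherwise; an atom $(x \doteq y \cdot z)$ holds if the values of $x,y,z$ all lie in $\mathsf{Facs}(w)$ and the value of $x$ is the concatenation of the values of $y$ and $z$. A language $L \subseteq \Sigma^*$ is an $\mathsf{FC}$-language if there is an $\mathsf{FC}$-sentence $\varphi$ (a formula without free variables) such that $L$ is the set of all $w \in \Sigma^*$ that satisfy $\varphi$. Then none of the following languages over $\Sigma$ is an $\mathsf{FC}$-language: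 - $L_1 = \{ a^n (ba)^n \mid n \in \mathbb{N} \}$, - $L_2 = \{ a^i (ba)^j \mid i, j \in \mathbb{N},\ 1 \le i \le j \}$, - $L_3 = \{ b^n a^m b^{n+m} \mid n, m \in \mathbb{N} \}$, - $L_4 = \{ b^n a^m b^{n \cdot m} \mid n, m \in \mathbb{N} \}$, - $L_5 = \{ (abaabb)^m (bbaaba)^m \mid m \in \mathbb{N} \}$, - $L_6 = \{ a^n b^n (ab)^n \mid n \in \mathbb{N} \}$, where $\mathbb{N} = \{0, 1, 2, \dots\}$. -/

import Mathlib

namespace FC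

/-- Terms over the signature: variables from a countably infinite set, one constant symbol
for every letter of the alphabet, and a constant symbol for the empty word. -/
inductive Term (α : Type*) where
  | var (x : ℕ)
  | letter (a : α)
  | eps

/-- FC-formulas. The only atomic formulas are the word equations `x ≐ y · z`. -/
inductive Formula (α : Type*) where
  | eqConcat (x y z : Term α)
  | and (φ ψ : Formula α)
  | or (φ ψ : Formula α)
  | not (φ : Formula α)
  | all (x : ℕ) (φ : Formula α)
  | ex (x : ℕ) (φ : Formula α)

variable {α : Type*}

/-- The variables that occur in a term. -/
def Term.vars : Term α → Set ℕ
  | .var x => {x}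
  | .letter _ => ∅
  | .eps => ∅

/-- The free variables of a formula. -/
def Formula.freeVars : Formula α → Set ℕ
  | .eqConcat x y z => x.vars ∪ y.vars ∪ z.vars
  | .and φ ψ => φ.freeVars ∪ ψ.freeVars
  | .or φ ψ => φ.freeVars ∪ ψ.freeVars
  | .not φ => φ.freeVars
  | .all x φ => φ.freeVars \ {x}
  | .ex x φ => φ.freeVars \ {x}

/-- A sentence is a formula without free variables. -/
def Formula.IsSentence (φ : Formula α) : Prop := φ.freeVars = ∅

/-- The set of factors (contiguous subwords) of `w`. -/
def Facs (w : List α) : Set (List α) := {u | u <:+: w}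

/-- The universe `Facs w ∪ {⊥}` of the structure representing `w`; `⊥` is `none`. -/
abbrev Univ (w : List α) : Type _ := Option (Facs w)

/-- The empty word, as a factor of `w`. -/
def epsFac (w : List α) : Facs w := ⟨[], List.nil_infix⟩

open Classical in
/-- The constant symbol of the letter `a` denotes the word `a` if `a` occurs in `w`, and `⊥`
otherwise. -/
noncomputable def letterVal (w : List α) (a : α) : Univ w :=
  if h : a ∈ w then some ⟨[a], by
    obtain ⟨s, t, hst⟩ := List.append_of_mem h
    exact ⟨s, t, by simp [hst]⟩⟩ else none

/-- Concatenation restricted to factors of `w`; it never holds if `⊥` is involved. -/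
def Concat (w : List α) (x y z : Univ w) : Prop :=
  ∃ u v t : Facs w, x = some u ∧ y = some v ∧ z = some t ∧ (u : List α) = v ++ t

/-- The value of a term. Variables are assigned factors of `w`, never `⊥`. -/
noncomputable def Term.val (w : List α) (σ : ℕ → Facs w) : Term α → Univ w
  | .var x => some (σ x)
  | .letter a => letterVal w a
  | .eps => some (epsFac w)

/-- Satisfaction of a formula in the structure representing `w`, under the assignment `σ`.
Quantifiers range over the factors of `w`. -/
def Sat (w : List α) : (ℕ → Facs w) → Formula α → Prop
  | σ, .eqConcat x y z => Concat w (x.val w σ) (y.val w σ) (z.val w σ)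
  | σ, .and φ ψ => Sat w σ φ ∧ Sat w σ ψ
  | σ, .or φ ψ => Sat w σ φ ∨ Sat w σ ψ
  | σ, .not φ => ¬ Sat w σ φ
  | σ, .all x φ => ∀ u : Facs w, Sat w (Function.update σ x u) φ
  | σ, .ex x φ => ∃ u : Facs w, Sat w (Function.update σ x u) φ

/-- `w ⊨ φ`. For a sentence, the choice of the assignment is immaterial (see `models_iff`). -/
def Models (w : List α) (φ : Formula α) : Prop := ∀ σ : ℕ → Facs w, Sat w σ φ

theorem Term.val_congr (w : List α) (σ τ : ℕ → Facs w) (t : Term α)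
    (h : ∀ x ∈ t.vars, σ x = τ x) : t.val w σ = t.val w τ := by
  cases t with
  | var x => exact congrArg some (h x rfl)
  | letter a => rfl
  | eps => rfl

theorem sat_congr (w : List α) (φ : Formula α) : ∀ (σ τ : ℕ → Facs w),
    (∀ x ∈ φ.freeVars, σ x = τ x) → (Sat w σ φ ↔ Sat w τ φ) := by
  induction φ with
  | eqConcat x y z =>
    intro σ τ h
    simp only [Formula.freeVars, Set.mem_union] at h
    simp only [Sat]
    rw [x.val_congr w σ τ (fun i hi => h i (by tauto)),
      y.val_congr w σ τ (fun i hi => h i (by tauto)),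
      z.val_congr w σ τ (fun i hi => h i (by tauto))]
  | and φ ψ ih1 ih2 =>
    intro σ τ h
    exact and_congr (ih1 σ τ fun x hx => h x (Or.inl hx)) (ih2 σ τ fun x hx => h x (Or.inr hx))
  | or φ ψ ih1 ih2 =>
    intro σ τ h
    exact or_congr (ih1 σ τ fun x hx => h x (Or.inl hx)) (ih2 σ τ fun x hx => h x (Or.inr hx))
  | not φ ih =>
    intro σ τ h
    exact not_congr (ih σ τ h)
  | all x φ ih =>
    intro σ τ h
    refine forall_congr' fun u => ih _ _ fun y hy => ?_
    by_cases hxy : y = x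
    · subst hxy; simp
    · simpa [Function.update_of_ne hxy] using h y ⟨hy, hxy⟩
  | ex x φ ih =>
    intro σ τ h
    refine exists_congr fun u => ih _ _ fun y hy => ?_
    by_cases hxy : y = x
    · subst hxy; simp
    · simpa [Function.update_of_ne hxy] using h y ⟨hy, hxy⟩

theorem models_iff (w : List α) (φ : Formula α) (hφ : φ.IsSentence) (σ : ℕ → Facs w) :
    Models w φ ↔ Sat w σ φ :=
  ⟨fun h => h σ, fun h τ => (sat_congr w φ σ τ (by
    intro x hx
    rw [Formula.IsSentence] at hφ
    simp [hφ] at hx)).mp h⟩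

/-- The language defined by a formula (used for sentences only). -/
def Formula.lang (φ : Formula α) : Language α := {w | Models w φ}

/-- `L` is an FC-language: it is the language of some FC-sentence. -/
def IsDefinable (L : Language α) : Prop := ∃ φ : Formula α, φ.IsSentence ∧ φ.lang = L

/-- The word consisting of `n` repetitions of `w`. -/
def wpow (w : List α) (n : ℕ) : List α := (List.replicate n w).flatten

end FC

/-! The proof is a Feferman–Vaught decomposition followed by the pigeonhole principle. Suppose the
words U ∈ A and V ∈ B have only finitely many factors in common. For a fixed formula, truth in UV is
then a relation between U and V with finitely many distinct rows (`exists_isRect_sat`). Each factor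
of UV is coded by a left piece from U and a right piece from V. In an equation between coded words,
any stretch where a left piece meets a right piece is a common factor, so finitely many overlaps
suffice (`splitEq_iff`). Connectives and quantifiers preserve finiteness of the set of rows.

Now let U = c sⁿ and let no V_j contain s. Long factors of c sⁿ contain s, so common factors are
short, and two exponents p < q have the same row (`exists_lt_models_iff`). Each language is refuted
by some V_j with c sᵖ V_j inside it and c s^q V_j outside (`not_isDefinable`). -/

namespace FC

/-! ### Relations with finitely many rows -/

section Rect

variable {X Y : Type*}

/-- A relation that is a finite union of rectangles, expressed by having finitely many rows. -/
def IsRect (R : X → Y → Prop) : Prop := (Set.range R).Finite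

theorem IsRect.left (P : X → Prop) : IsRect (fun x (_ : Y) => P x) := by
  refine (Set.toFinite {(fun _ => True : Y → Prop), fun _ => False}).subset ?_
  rintro _ ⟨x, rfl⟩
  by_cases h : P x <;> simp [h]

theorem IsRect.right (Q : Y → Prop) : IsRect (fun (_ : X) y => Q y) := by
  refine (Set.finite_singleton Q).subset ?_
  rintro _ ⟨x, rfl⟩
  rfl

theorem IsRect.comp {X' Y' : Type*} {R : X' → Y' → Prop} (h : IsRect R) (f : X → X')
    (g : Y → Y') : IsRect (fun x y => R (f x) (g y)) := by
  refine (Set.Finite.image (fun P y => P (g y)) h).subset ?_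
  rintro _ ⟨x, rfl⟩
  exact ⟨R (f x), ⟨f x, rfl⟩, rfl⟩

theorem IsRect.not {R : X → Y → Prop} (h : IsRect R) : IsRect (fun x y => ¬ R x y) := by
  refine (Set.Finite.image (fun P y => ¬ P y) h).subset ?_
  rintro _ ⟨x, rfl⟩
  exact ⟨R x, ⟨x, rfl⟩, rfl⟩

theorem IsRect.and {R R' : X → Y → Prop} (h : IsRect R) (h' : IsRect R') :
    IsRect (fun x y => R x y ∧ R' x y) := by
  refine (Set.Finite.image2 (fun P P' y => P y ∧ P' y) h h').subset ?_
  rintro _ ⟨x, rfl⟩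
  exact ⟨R x, ⟨x, rfl⟩, R' x, ⟨x, rfl⟩, rfl⟩

theorem IsRect.or {R R' : X → Y → Prop} (h : IsRect R) (h' : IsRect R') :
    IsRect (fun x y => R x y ∨ R' x y) := by
  refine (Set.Finite.image2 (fun P P' y => P y ∨ P' y) h h').subset ?_
  rintro _ ⟨x, rfl⟩
  exact ⟨R x, ⟨x, rfl⟩, R' x, ⟨x, rfl⟩, rfl⟩

theorem IsRect.prod (P : X → Prop) (Q : Y → Prop) : IsRect (fun x y => P x ∧ Q y) :=
  (IsRect.left P).and (IsRect.right Q)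

theorem IsRect.exists_mem {ι : Type*} {S : Set ι} (hS : S.Finite) {R : ι → X → Y → Prop}
    (h : ∀ i, IsRect (R i)) : IsRect (fun x y => ∃ i ∈ S, R i x y) := by
  induction S, hS using Set.Finite.induction_on with
  | empty => simpa using IsRect.left (fun _ => False)
  | insert _ _ ih => simpa using (h _).or ih

/-- The new row at `x` depends only on the set of rows `R (f x z)`, a subset of the finite set of
rows of `R`. It is essential that `z` is paired with `x` alone and `w` with `y` alone. -/
theorem IsRect.exists₂ {X' Y' Z W : Type*} {R : X' → Y' → Prop} (h : IsRect R)
    (f : X → Z → X') (g : Y → W → Y') :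
    IsRect (fun x y => ∃ z w, R (f x z) (g y w)) := by
  refine (Set.Finite.image (fun (C : Set (Y' → Prop)) y => ∃ P ∈ C, ∃ w, P (g y w))
    h.finite_subsets).subset ?_
  rintro _ ⟨x, rfl⟩
  refine ⟨Set.range fun z => R (f x z), ?_, ?_⟩
  · rintro _ ⟨z, rfl⟩
    exact ⟨_, rfl⟩
  · funext y
    simp

end Rect

/-! ### Coding factors of a concatenation -/

variable {α : Type*}

/-- The pair `(l, r)` is a way of writing a factor of `U ++ V` as `l ++ r`. -/
def IsCode (U V l r : List α) : Prop :=
  (l <:+: U ∧ r = []) ∨ (l = [] ∧ r <:+: V) ∨ (l <:+ U ∧ r <+: V)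

theorem IsCode.left {U V l r : List α} (h : IsCode U V l r) : l <:+: U := by
  rcases h with h | h | h
  · exact h.1
  · rw [h.1]; exact List.nil_infix
  · exact h.1.isInfix

theorem IsCode.right {U V l r : List α} (h : IsCode U V l r) : r <:+: V := by
  rcases h with h | h | h
  · rw [h.2]; exact List.nil_infix
  · exact h.2
  · exact h.2.isInfix

theorem IsCode.infix_append {U V l r : List α} (h : IsCode U V l r) : l ++ r <:+: U ++ V := by
  rcases h with ⟨h, rfl⟩ | ⟨rfl, h⟩ | ⟨⟨s, rfl⟩, ⟨t, rfl⟩⟩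
  · simpa using h.trans (List.prefix_append U V).isInfix
  · simpa using h.trans (List.suffix_append U V).isInfix
  · exact ⟨s, t, by simp⟩

/-- A factor may have several codes; this is harmless because satisfaction depends only on `l ++ r`.
-/
theorem exists_isCode {U V u : List α} (h : u <:+: U ++ V) :
    ∃ l r, IsCode U V l r ∧ u = l ++ r := by
  obtain ⟨s, t, h⟩ := h
  rw [List.append_assoc, List.append_eq_append_iff] at h
  rcases h with ⟨x, rfl, h⟩ | ⟨x, rfl, h⟩
  · rcases List.append_eq_append_iff.mp h with ⟨y, rfl, h'⟩ | ⟨y, rfl, h'⟩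
    · exact ⟨u, [], Or.inl ⟨⟨s, y, by simp⟩, rfl⟩, by simp⟩
    · exact ⟨x, y, Or.inr (Or.inr ⟨⟨s, rfl⟩, ⟨t, h'.symm⟩⟩), rfl⟩
  · exact ⟨[], u, Or.inr (Or.inl ⟨rfl, ⟨x, t, by simp [h]⟩⟩), by simp⟩

theorem isRect_isCode {X Y : Type*} (f f' : X → List α) (g g' : Y → List α) :
    IsRect (fun x y => IsCode (f x) (g y) (f' x) (g' y)) :=
  (IsRect.prod (fun x => f' x <:+: f x) (fun y => g' y = [])).or
    ((IsRect.prod (fun x => f' x = []) (fun y => g' y <:+: g y)).or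
      (IsRect.prod (fun x => f' x <:+ f x) (fun y => g' y <+: g y)))

/-- The equation `l₁r₁ = l₂r₂l₃r₃`, as a union of rectangles over the possible overlaps. -/
def SplitEq (S : Set (List α)) (l r : List α × List α × List α) : Prop :=
  ∃ e ∈ S, ∃ d ∈ S,
    ((l.2.1 = l.1 ++ e ∧ l.2.2 = d) ∧ r.1 = e ++ r.2.1 ++ d ++ r.2.2) ∨
    ((l.1 = l.2.1 ++ e ∧ l.2.2 = d) ∧ ∃ t, r.2.1 = e ++ t ∧ r.1 = t ++ d ++ r.2.2) ∨
    ((∃ t, l.1 = l.2.1 ++ e ++ t ∧ l.2.2 = t ++ d) ∧ r.2.1 = e ∧ r.1 = d ++ r.2.2) ∨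
    (l.1 = l.2.1 ++ e ++ l.2.2 ++ d ∧ r.2.1 = e ∧ r.2.2 = d ++ r.1)

/-- For fixed `e` and `d`, each disjunct constrains the left words and the right words separately.
-/
theorem isRect_splitEq {S : Set (List α)} (hS : S.Finite) : IsRect (SplitEq S) :=
  IsRect.exists_mem hS fun e => IsRect.exists_mem hS fun d =>
    (IsRect.prod (fun l : List α × List α × List α => l.2.1 = l.1 ++ e ∧ l.2.2 = d)
      (fun r : List α × List α × List α => r.1 = e ++ r.2.1 ++ d ++ r.2.2)).or <|
    (IsRect.prod (fun l : List α × List α × List α => l.1 = l.2.1 ++ e ∧ l.2.2 = d)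
      (fun r : List α × List α × List α =>
        ∃ t, r.2.1 = e ++ t ∧ r.1 = t ++ d ++ r.2.2)).or <|
    (IsRect.prod (fun l : List α × List α × List α =>
        ∃ t, l.1 = l.2.1 ++ e ++ t ∧ l.2.2 = t ++ d)
      (fun r : List α × List α × List α => r.2.1 = e ∧ r.1 = d ++ r.2.2)).or <|
    IsRect.prod (fun l : List α × List α × List α => l.1 = l.2.1 ++ e ++ l.2.2 ++ d)
      (fun r : List α × List α × List α => r.2.1 = e ∧ r.2.2 = d ++ r.1)

/-- The four disjuncts record whether `l₁` ends within `l₂`, `r₂`, `l₃` or `r₃`. Where a left word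
is matched against a right word, the overlap is a factor of both `U` and `V`, hence lies in `S`. -/
theorem splitEq_iff {S : Set (List α)} {U V : List α}
    (hS : ∀ x, x <:+: U → x <:+: V → x ∈ S) {l₁ l₂ l₃ r₁ r₂ r₃ : List α}
    (hl₁ : l₁ <:+: U) (hl₂ : l₂ <:+: U) (hl₃ : l₃ <:+: U)
    (hr₁ : r₁ <:+: V) (hr₂ : r₂ <:+: V) (hr₃ : r₃ <:+: V) :
    SplitEq S (l₁, l₂, l₃) (r₁, r₂, r₃) ↔ l₁ ++ r₁ = (l₂ ++ r₂) ++ (l₃ ++ r₃) := by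
  constructor
  · rintro ⟨e, -, d, -, ⟨⟨h, h'⟩, h''⟩ | ⟨⟨h, h'⟩, t, h'', h3⟩ | ⟨⟨t, h, h'⟩, h'', h3⟩ |
      ⟨h, h', h''⟩⟩ <;> simp only at * <;> simp [*]
  · intro h
    rw [List.append_assoc, List.append_eq_append_iff] at h
    rcases h with ⟨e, rfl, h⟩ | ⟨e, rfl, h⟩
    · refine ⟨e, hS _ (List.IsInfix.trans ⟨l₁, [], by simp⟩ hl₂)
        (List.IsInfix.trans ⟨[], r₂ ++ (l₃ ++ r₃), by simp [h]⟩ hr₁), l₃,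
        hS _ hl₃ (List.IsInfix.trans ⟨e ++ r₂, r₃, by simp [h]⟩ hr₁), Or.inl ?_⟩
      simp [h]
    · rw [List.append_eq_append_iff] at h
      rcases h with ⟨t, rfl, h⟩ | ⟨t, rfl, h⟩
      · rw [List.append_eq_append_iff] at h
        rcases h with ⟨d, rfl, h⟩ | ⟨d, rfl, h⟩
        · refine ⟨r₂, hS _ (List.IsInfix.trans ⟨l₂, l₃ ++ d, by simp⟩ hl₁) hr₂, d,
            hS _ (List.IsInfix.trans ⟨l₂ ++ (r₂ ++ l₃), [], by simp⟩ hl₁)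
              (List.IsInfix.trans ⟨[], r₁, by simp [h]⟩ hr₃), ?_⟩
          exact Or.inr (Or.inr (Or.inr ⟨by simp, rfl, h⟩))
        · refine ⟨r₂, hS _ (List.IsInfix.trans ⟨l₂, t, by simp⟩ hl₁) hr₂, d,
            hS _ (List.IsInfix.trans ⟨t, [], by simp⟩ hl₃)
              (List.IsInfix.trans ⟨[], r₃, by simp [h]⟩ hr₁), ?_⟩
          exact Or.inr (Or.inr (Or.inl ⟨⟨t, by simp, rfl⟩, rfl, h⟩))
      · refine ⟨e, hS _ (List.IsInfix.trans ⟨l₂, [], by simp⟩ hl₁)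
          (List.IsInfix.trans ⟨[], t, by simp⟩ hr₂), l₃,
          hS _ hl₃ (List.IsInfix.trans ⟨t, r₃, by simp [h]⟩ hr₁), Or.inr (Or.inl ?_)⟩
        exact ⟨⟨rfl, rfl⟩, t, rfl, by simp [h]⟩

/-- `(l, r)` codes the value of the term when the variables are coded by `x.2` and `y.2`. -/
def Term.HasCode (x y : List α × (ℕ → List α)) (l r : List α) : Term α → Prop
  | .var n => l = x.2 n ∧ r = y.2 n
  | .letter c => ((c ∈ x.1 ∧ l = [c]) ∧ r = []) ∨ (l = [] ∧ c ∈ y.1 ∧ r = [c])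
  | .eps => l = [] ∧ r = []

theorem Term.isRect_hasCode {X Y : Type*} (f : X → List α × (ℕ → List α))
    (g : Y → List α × (ℕ → List α)) (f' : X → List α) (g' : Y → List α) (t : Term α) :
    IsRect (fun x y => t.HasCode (f x) (g y) (f' x) (g' y)) := by
  cases t with
  | var n => exact IsRect.prod (fun x => f' x = (f x).2 n) (fun y => g' y = (g y).2 n)
  | letter c =>
    exact (IsRect.prod (fun x => c ∈ (f x).1 ∧ f' x = [c]) (fun y => g' y = [])).or
      (IsRect.prod (fun x => f' x = []) (fun y => c ∈ (g y).1 ∧ g' y = [c]))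
  | eps => exact IsRect.prod (fun x => f' x = []) (fun y => g' y = [])

theorem Term.HasCode.infix {U V : List α} {lam rho : ℕ → List α}
    (hc : ∀ n, IsCode U V (lam n) (rho n)) {t : Term α} {l r : List α}
    (h : t.HasCode (U, lam) (V, rho) l r) : l <:+: U ∧ r <:+: V := by
  cases t with
  | var n => obtain ⟨rfl, rfl⟩ := h; exact ⟨(hc n).left, (hc n).right⟩
  | letter c =>
    rcases h with ⟨⟨h, rfl⟩, rfl⟩ | ⟨rfl, h, rfl⟩
    · exact ⟨(List.singleton_infix_iff _ _).mpr h, List.nil_infix⟩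
    · exact ⟨List.nil_infix, (List.singleton_infix_iff _ _).mpr h⟩
  | eps => obtain ⟨rfl, rfl⟩ := h; exact ⟨List.nil_infix, List.nil_infix⟩

/-- A letter occurring in both `U` and `V` has two codes; a letter occurring in neither has none,
which is how ⊥ is represented. -/
theorem Term.val_eq_some_iff {U V : List α} {lam rho : ℕ → List α}
    {σ : ℕ → Facs (U ++ V)} (hσ : ∀ n, (σ n : List α) = lam n ++ rho n) (t : Term α)
    (u : List α) :
    (∃ v : Facs (U ++ V), t.val (U ++ V) σ = some v ∧ (v : List α) = u) ↔
      ∃ l r, t.HasCode (U, lam) (V, rho) l r ∧ u = l ++ r := by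
  cases t with
  | var n => simp [Term.val, Term.HasCode, hσ, eq_comm]
  | letter c =>
    by_cases hU : c ∈ U <;> by_cases hV : c ∈ V <;>
      simp [Term.val, Term.HasCode, letterVal, hU, hV, eq_comm, or_and_right, exists_or, and_assoc]
  | eps => simp [Term.val, Term.HasCode, epsFac, eq_comm]

/-! ### The decomposition theorem -/

/-- Feferman–Vaught: satisfaction over `U ++ V` is a finite union of rectangles if the words `U`
and the words `V` have only finitely many factors in common. -/
theorem exists_isRect_sat {A B S : Set (List α)} (hfin : S.Finite)
    (hS : ∀ U ∈ A, ∀ V ∈ B, ∀ x, x <:+: U → x <:+: V → x ∈ S) (φ : Formula α) :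
    ∃ R : List α × (ℕ → List α) → List α × (ℕ → List α) → Prop, IsRect R ∧
      ∀ U ∈ A, ∀ V ∈ B, ∀ lam rho, (∀ n, IsCode U V (lam n) (rho n)) →
        ∀ σ : ℕ → Facs (U ++ V), (∀ n, (σ n : List α) = lam n ++ rho n) →
          (Sat (U ++ V) σ φ ↔ R (U, lam) (V, rho)) := by
  have quant : ∀ (n : ℕ) (φ : Formula α)
      (R : List α × (ℕ → List α) → List α × (ℕ → List α) → Prop), IsRect R →
      (∀ U ∈ A, ∀ V ∈ B, ∀ lam rho, (∀ n, IsCode U V (lam n) (rho n)) →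
        ∀ σ : ℕ → Facs (U ++ V), (∀ n, (σ n : List α) = lam n ++ rho n) →
          (Sat (U ++ V) σ φ ↔ R (U, lam) (V, rho))) →
      ∃ R' : List α × (ℕ → List α) → List α × (ℕ → List α) → Prop, IsRect R' ∧
        ∀ U ∈ A, ∀ V ∈ B, ∀ lam rho, (∀ n, IsCode U V (lam n) (rho n)) →
          ∀ σ : ℕ → Facs (U ++ V), (∀ n, (σ n : List α) = lam n ++ rho n) →
            ((∃ u, Sat (U ++ V) (Function.update σ n u) φ) ↔ R' (U, lam) (V, rho)) := by
    intro n φ R hR h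
    -- Quantifying over a factor becomes quantifying over its two pieces; the condition tying them
    -- together is itself rectangular, so `IsRect.exists₂` applies.
    refine ⟨_, ((isRect_isCode (fun x : List α × (ℕ → List α) => x.1) (fun x => x.2 n)
      (fun y : List α × (ℕ → List α) => y.1) (fun y => y.2 n)).and
      hR).exists₂ (fun x l => (x.1, Function.update x.2 n l))
      (fun y r => (y.1, Function.update y.2 n r)), ?_⟩
    intro U hU V hV lam rho hc σ hσ
    have key : ∀ (l r : List α) (u : Facs (U ++ V)), IsCode U V l r → (u : List α) = l ++ r →
        (Sat (U ++ V) (Function.update σ n u) φ ↔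
          R (U, Function.update lam n l) (V, Function.update rho n r)) := by
      intro l r u hlr hu
      refine h U hU V hV _ _ (fun m => ?_) _ (fun m => ?_)
      · by_cases hm : m = n
        · subst hm; simpa using hlr
        · simpa [Function.update_of_ne hm] using hc m
      · by_cases hm : m = n
        · subst hm; simpa using hu
        · simpa [Function.update_of_ne hm] using hσ m
    simp only [Function.update_self]
    constructor
    · rintro ⟨u, hu⟩
      obtain ⟨l, r, hlr, hur⟩ := exists_isCode u.2
      exact ⟨l, r, hlr, (key l r u hlr hur).mp hu⟩
    · rintro ⟨l, r, hlr, hR'⟩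
      exact ⟨⟨l ++ r, hlr.infix_append⟩, (key l r _ hlr rfl).mpr hR'⟩
  induction φ with
  | eqConcat t₁ t₂ t₃ =>
    let f : (List α × (ℕ → List α)) × List α × List α × List α → List α × (ℕ → List α) := Prod.fst
    refine ⟨_, (((t₁.isRect_hasCode f f (fun x => x.2.1) (fun y => y.2.1)).and
      ((t₂.isRect_hasCode f f (fun x => x.2.2.1) (fun y => y.2.2.1)).and
        (t₃.isRect_hasCode f f (fun x => x.2.2.2) (fun y => y.2.2.2)))).and
      ((isRect_splitEq hfin).comp Prod.snd Prod.snd)).exists₂ (fun x l => (x, l))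
      (fun y r => (y, r)), ?_⟩
    intro U hU V hV lam rho hc σ hσ
    have e₁ := t₁.val_eq_some_iff hσ
    have e₂ := t₂.val_eq_some_iff hσ
    have e₃ := t₃.val_eq_some_iff hσ
    simp only [Sat, f]
    constructor
    · rintro ⟨u, v, t, h₁, h₂, h₃, h⟩
      obtain ⟨l₁, r₁, c₁, d₁⟩ := (e₁ _).mp ⟨u, h₁, rfl⟩
      obtain ⟨l₂, r₂, c₂, d₂⟩ := (e₂ _).mp ⟨v, h₂, rfl⟩
      obtain ⟨l₃, r₃, c₃, d₃⟩ := (e₃ _).mp ⟨t, h₃, rfl⟩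
      refine ⟨(l₁, l₂, l₃), (r₁, r₂, r₃), ⟨c₁, c₂, c₃⟩, ?_⟩
      rw [splitEq_iff (hS U hU V hV) (c₁.infix hc).1 (c₂.infix hc).1 (c₃.infix hc).1
        (c₁.infix hc).2 (c₂.infix hc).2 (c₃.infix hc).2, ← d₁, ← d₂, ← d₃, h]
    · rintro ⟨⟨l₁, l₂, l₃⟩, ⟨r₁, r₂, r₃⟩, ⟨c₁, c₂, c₃⟩, h⟩
      rw [splitEq_iff (hS U hU V hV) (c₁.infix hc).1 (c₂.infix hc).1 (c₃.infix hc).1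
        (c₁.infix hc).2 (c₂.infix hc).2 (c₃.infix hc).2] at h
      obtain ⟨u, h₁, d₁⟩ := (e₁ _).mpr ⟨l₁, r₁, c₁, rfl⟩
      obtain ⟨v, h₂, d₂⟩ := (e₂ _).mpr ⟨l₂, r₂, c₂, rfl⟩
      obtain ⟨t, h₃, d₃⟩ := (e₃ _).mpr ⟨l₃, r₃, c₃, rfl⟩
      exact ⟨u, v, t, h₁, h₂, h₃, by rw [d₁, d₂, d₃, h]⟩
  | and φ ψ ih₁ ih₂ =>
    obtain ⟨R₁, hR₁, h₁⟩ := ih₁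
    obtain ⟨R₂, hR₂, h₂⟩ := ih₂
    exact ⟨_, hR₁.and hR₂, fun U hU V hV lam rho hc σ hσ =>
      and_congr (h₁ U hU V hV lam rho hc σ hσ) (h₂ U hU V hV lam rho hc σ hσ)⟩
  | or φ ψ ih₁ ih₂ =>
    obtain ⟨R₁, hR₁, h₁⟩ := ih₁
    obtain ⟨R₂, hR₂, h₂⟩ := ih₂
    exact ⟨_, hR₁.or hR₂, fun U hU V hV lam rho hc σ hσ =>
      or_congr (h₁ U hU V hV lam rho hc σ hσ) (h₂ U hU V hV lam rho hc σ hσ)⟩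
  | not φ ih =>
    obtain ⟨R, hR, h⟩ := ih
    exact ⟨_, hR.not, fun U hU V hV lam rho hc σ hσ => not_congr (h U hU V hV lam rho hc σ hσ)⟩
  | all n φ ih =>
    obtain ⟨R, hR, h⟩ := ih
    -- ∀ is treated as ¬∃¬.
    obtain ⟨R', hR', h'⟩ := quant n (.not φ) _ hR.not fun U hU V hV lam rho hc σ hσ =>
      not_congr (h U hU V hV lam rho hc σ hσ)
    refine ⟨_, hR'.not, fun U hU V hV lam rho hc σ hσ => ?_⟩
    rw [← h' U hU V hV lam rho hc σ hσ]
    simp [Sat]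
  | ex n φ ih =>
    obtain ⟨R, hR, h⟩ := ih
    exact quant n φ R hR h

/-! ### Powers of a word and the pigeonhole argument -/

theorem wpow_zero (s : List α) : wpow s 0 = [] := rfl

theorem wpow_succ (s : List α) (n : ℕ) : wpow s (n + 1) = s ++ wpow s n := by
  simp [wpow, List.replicate_succ]

theorem wpow_add (s : List α) (m n : ℕ) : wpow s (m + n) = wpow s m ++ wpow s n := by
  rw [wpow, List.replicate_add, List.flatten_append, wpow, wpow]

theorem wpow_append_self (s : List α) (n : ℕ) : wpow (s ++ s) n = wpow s (2 * n) := by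
  induction n with
  | zero => rfl
  | succ n ih => rw [wpow_succ, ih, Nat.mul_succ, wpow_succ, wpow_succ, List.append_assoc]

theorem count_wpow [DecidableEq α] (c : α) (s : List α) (n : ℕ) :
    (wpow s n).count c = n * s.count c := by
  simp [wpow, List.count_flatten]

theorem length_wpow (s : List α) (n : ℕ) : (wpow s n).length = n * s.length := by
  simp [wpow]

/-- A factor starting inside `c` is long enough to run through the rest of `c` and the next copy of
`s`. A factor starting later lies in the power of `s`; its first copy then plays the role of `c`,
which is why the bound `2 * s.length` is carried along. -/
theorem infix_of_infix_append_wpow {s : List α} (n : ℕ) : ∀ {c x : List α},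
    x <:+: c ++ wpow s n → c.length + s.length ≤ x.length → 2 * s.length ≤ x.length →
      s <:+: x := by
  induction n with
  | zero =>
    intro c x h hc _
    have := h.length_le
    simp only [wpow_zero, List.append_nil] at this
    have : s = [] := List.length_eq_zero_iff.mp (by omega)
    exact this ▸ List.nil_infix
  | succ n ih =>
    rintro c x ⟨p, q, h⟩ hc hx
    rw [List.append_assoc, List.append_eq_append_iff] at h
    rcases h with ⟨c', rfl, h⟩ | ⟨p', rfl, h⟩
    · simp only [List.length_append] at hc
      rw [wpow_succ, ← List.append_assoc] at h
      obtain ⟨x', rfl⟩ : c' ++ s <+: x :=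
        List.prefix_of_prefix_length_le ⟨_, h.symm⟩ ⟨q, rfl⟩ (by simp; omega)
      exact ⟨c', x', rfl⟩
    · rw [wpow_succ] at h
      exact ih (c := s) ⟨p', q, by simpa using h.symm⟩ (by omega) hx

/-- If `s` is not a factor of any of the words `V j`, then an FC-sentence cannot tell apart
some two powers of `s` in the words `c ++ wpow s n ++ V j`, uniformly in `j`. -/
theorem exists_lt_models_iff [Finite α] {ι : Type*} (c s : List α) (V : ι → List α)
    (hV : ∀ j, ¬ s <:+: V j) (φ : Formula α) (hφ : φ.IsSentence) :
    ∃ p q, 1 ≤ p ∧ p < q ∧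
      ∀ j, Models (c ++ wpow s p ++ V j) φ ↔ Models (c ++ wpow s q ++ V j) φ := by
  obtain ⟨R, hR, h⟩ := exists_isRect_sat (A := Set.range fun n => c ++ wpow s n)
    (B := Set.range V) (List.finite_length_lt α (c.length + 2 * s.length)) (by
      rintro _ ⟨n, rfl⟩ _ ⟨j, rfl⟩ x hx hxV
      by_contra hlen
      simp only [Set.mem_ofPred_eq, not_lt] at hlen
      -- A long common factor would carry `s` into `V j`; over a finite alphabet only finitely many
      -- short words remain.
      exact hV j ((infix_of_infix_append_wpow n hx (by omega) (by omega)).trans hxV)) φ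
  have hmod : ∀ n j, Models (c ++ wpow s n ++ V j) φ ↔
      R (c ++ wpow s n, fun _ => []) (V j, fun _ => []) := fun n j => by
    rw [models_iff _ φ hφ fun _ => epsFac _]
    exact h _ ⟨n, rfl⟩ _ ⟨j, rfl⟩ _ _ (fun _ => Or.inl ⟨List.nil_infix, rfl⟩) _ fun _ => rfl
  -- Pigeonhole on the rows. Starting at 1 serves the language that demands `1 ≤ i`.
  obtain ⟨p, hp, q, -, hpq, hR⟩ := (Set.Ici_infinite 1).exists_lt_map_eq_of_mapsTo
    (f := fun n : ℕ => R (c ++ wpow s n, fun _ => []))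
    (t := Set.range R) (fun n _ => ⟨_, rfl⟩) hR
  exact ⟨p, q, hp, hpq, fun j => by rw [hmod, hmod]; exact iff_of_eq (congrFun hR _)⟩

theorem not_isDefinable [Finite α] {ι : Type*} {L : Language α} (c s : List α) (V : ι → List α)
    (hV : ∀ j, ¬ s <:+: V j)
    (h : ∀ p q, 1 ≤ p → p < q → ∃ j, c ++ wpow s p ++ V j ∈ L ∧ c ++ wpow s q ++ V j ∉ L) :
    ¬ IsDefinable L := by
  rintro ⟨φ, hφ, rfl⟩
  obtain ⟨p, q, hp, hpq, hiff⟩ := exists_lt_models_iff c s V hV φ hφ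
  obtain ⟨j, hmem, hnot⟩ := h p q hp hpq
  exact hnot ((hiff j).mp hmem)

/-! ### Blocks that the right-hand words avoid -/

section Words

variable {a b : α}

theorem not_infix_wpow_pair (hab : a ≠ b) (n : ℕ) : ¬ [a, a] <:+: wpow [b, a] n := by
  induction n with
  | zero => simp [wpow_zero]
  | succ n ih =>
    rw [wpow_succ]
    -- An occurrence starting in the first block ends by the second, so unrolling two blocks
    -- suffices.
    cases n <;> simp_all [wpow_succ, wpow_zero, List.infix_cons_iff]

theorem not_infix_wpow_append (hab : a ≠ b) (m n : ℕ) :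
    ¬ [a, a] <:+: wpow [b] m ++ wpow [a, b] n := by
  induction m with
  | zero =>
    induction n with
    | zero => simp [wpow_zero]
    | succ n ih =>
      simp only [wpow_zero, List.nil_append] at ih
      simp [wpow_zero, wpow_succ, List.infix_cons_iff, hab, ih]
  | succ m ih => simp [wpow_succ, List.infix_cons_iff, hab, ih]

theorem not_singleton_infix_wpow (hab : a ≠ b) (n : ℕ) : ¬ [a] <:+: wpow [b] n := by
  simp [wpow, List.singleton_infix_iff, hab]

theorem not_infix_wpow_six (hab : a ≠ b) (n : ℕ) :
    ¬ [a, b, a, a, b, b] <:+: wpow [b, b, a, a, b, a] n := by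
  induction n with
  | zero => simp [wpow_zero]
  | succ n ih =>
    rw [wpow_succ]
    cases n <;> simp_all [wpow_succ, wpow_zero, List.infix_cons_iff, hab.symm]

end Words

end FC

/-! ### The six languages -/

open FC in
theorem mainTheorem6 {α : Type*} [Finite α] (a b : α) (hab : a ≠ b) :
    ¬ FC.IsDefinable {w : List α | ∃ n : ℕ, w = FC.wpow [a] n ++ FC.wpow [b, a] n} ∧
    ¬ FC.IsDefinable {w : List α | ∃ i j : ℕ, 1 ≤ i ∧ i ≤ j ∧
        w = FC.wpow [a] i ++ FC.wpow [b, a] j} ∧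
    ¬ FC.IsDefinable {w : List α | ∃ n m : ℕ,
        w = FC.wpow [b] n ++ FC.wpow [a] m ++ FC.wpow [b] (n + m)} ∧
    ¬ FC.IsDefinable {w : List α | ∃ n m : ℕ,
        w = FC.wpow [b] n ++ FC.wpow [a] m ++ FC.wpow [b] (n * m)} ∧
    ¬ FC.IsDefinable {w : List α | ∃ m : ℕ,
        w = FC.wpow [a, b, a, a, b, b] m ++ FC.wpow [b, b, a, a, b, a] m} ∧
    ¬ FC.IsDefinable {w : List α | ∃ n : ℕ,
        w = FC.wpow [a] n ++ FC.wpow [b] n ++ FC.wpow [a, b] n} := by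
  classical
  have aa : ∀ n, wpow [a, a] n = wpow [a] (2 * n) := wpow_append_self [a]
  refine ⟨?_, ?_, ?_, ?_, ?_, ?_⟩
  -- The repeated block is `aa` because the single letter `a` does occur in `(ba)ⁿ`.
  · refine not_isDefinable [] [a, a] (wpow [b, a]) (not_infix_wpow_pair hab)
      fun p q hp hpq => ⟨2 * p, ⟨2 * p, by simp [aa]⟩, ?_⟩
    rintro ⟨n, h⟩
    have h₁ := congrArg (List.count a) h
    have h₂ := congrArg (List.count b) h
    simp [count_wpow, hab, hab.symm] at h₁ h₂
    omega
  · refine not_isDefinable [] [a, a] (wpow [b, a]) (not_infix_wpow_pair hab)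
      fun p q hp hpq => ⟨2 * p, ⟨2 * p, 2 * p, by omega, le_rfl, by simp [aa]⟩, ?_⟩
    rintro ⟨i, j, -, hij, h⟩
    have h₁ := congrArg (List.count a) h
    have h₂ := congrArg (List.count b) h
    simp [count_wpow, hab, hab.symm] at h₁ h₂
    omega
  -- The slice `n = 0` already suffices.
  · refine not_isDefinable [] [a] (wpow [b]) (not_singleton_infix_wpow hab)
      fun p q hp hpq => ⟨p, ⟨0, p, by simp [wpow_zero]⟩, ?_⟩
    rintro ⟨n, m, h⟩
    have h₁ := congrArg (List.count a) h
    have h₂ := congrArg (List.count b) h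
    simp [count_wpow, hab, hab.symm] at h₁ h₂
    omega
  -- The slice `n = 1`, with `c = b`: the word `b aᵖ bᵖ` is in the language. For `b a^q bᵖ`,
  -- counting `b` would require `1 + p = n + n * q` with `n ≥ 1`, hence `p ≥ q`.
  · refine not_isDefinable [b] [a] (wpow [b]) (not_singleton_infix_wpow hab)
      fun p q hp hpq => ⟨p, ⟨1, p, by simp [wpow_zero, wpow_succ]⟩, ?_⟩
    rintro ⟨n, m, h⟩
    have h₁ := congrArg (List.count a) h
    have h₂ := congrArg (List.count b) h
    simp [count_wpow, hab, hab.symm] at h₁ h₂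
    subst h₁
    have hn : 1 ≤ n := by
      rcases n with _ | n
      · simp at h₂
      · omega
    have := Nat.mul_le_mul_right q hn
    omega
  · refine not_isDefinable [] [a, b, a, a, b, b] (wpow [b, b, a, a, b, a])
      (not_infix_wpow_six hab) fun p q hp hpq => ⟨p, ⟨p, by simp⟩, ?_⟩
    rintro ⟨m, h⟩
    have hl := congrArg List.length h
    simp [length_wpow] at hl
    -- Both blocks have three `a` and three `b`, so counting only gives `p + q = 2m`, hence `m < q`.
    -- Cancelling `m` copies of the first block leaves a word starting with `a` on one side and with
    -- `b` on the other.
    obtain ⟨k, rfl⟩ : ∃ k, q = m + (k + 1) := ⟨q - m - 1, by omega⟩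
    obtain ⟨l, rfl⟩ : ∃ l, m = l + 1 := ⟨m - 1, by omega⟩
    rw [wpow_add _ (l + 1) (k + 1), List.nil_append, List.append_assoc,
      List.append_cancel_left_eq] at h
    simp [wpow_succ, hab] at h
  -- Here `V n` is the whole remainder `bⁿ(ab)ⁿ`; its count of `b` fixes the exponent.
  · refine not_isDefinable [] [a, a] (fun n => wpow [b] n ++ wpow [a, b] n)
      (fun n => not_infix_wpow_append hab n n)
      fun p q hp hpq => ⟨2 * p, ⟨2 * p, by simp [aa]⟩, ?_⟩
    rintro ⟨n, h⟩
    have h₁ := congrArg (List.count a) h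
    have h₂ := congrArg (List.count b) h
    simp [count_wpow, hab, hab.symm] at h₁ h₂
    omega
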